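/- **Theorem 1.1.** For integers $m\ge 1$, $n\ge 0$ let $H_n^{(m)}=\sum_{j=1}^n j^{-m}$ and $H_n=H_n^{(1)}$. For $n\ge 0$ and nonzero integers $s_1,\dots,s_r$ let $$\zeta_n^\star(s_1,\dots,s_r)=\sum_{n\ge n_1\ge\cdots\ge n_r\ge 1}\ \prod_{j=1}^r \frac{\operatorname{sgn}(s_j)^{n_j}}{n_j^{|s_j|}},$$ where $\bar p$ denotes the negative entry $-p$ and an empty sum is $0$; let $\zeta$ be the Riemann zeta function. Then for every positive integer $k$ the following two series converge, with sums $$\begin{aligned} \sum_{n=1}^\infty \frac{H_nH_n^{(2)}}{n+k}(-1)^{n+k}={}&-\tfrac{5}{16}\zeta(4)-\tfrac14\zeta(2)\ln^2 2+\tfrac78\zeta(3)\ln 2+\tfrac78\zeta(3)\zeta_{k-1}^\star(\bar1)-\tfrac14\zeta(3)H_{k-1}\\ &-\tfrac12\zeta(2)\zeta_{k-1}^\star(\bar2)-\zeta_{k-1}^\star(3,\bar1)+\zeta_{k-1}^\star(1,2,\bar1)+\tfrac12\zeta(2)\zeta_{k-1}^\star(1,\bar1)+\zeta_{k-1}^\star(2,1,\bar1)\\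 &+\ln 2\,\{\zeta_{k-1}^\star(\bar3)-\zeta_{k-1}^\star(3)\}-\tfrac12\ln 2\,\zeta(2)\{\zeta_{k-1}^\star(\bar1)-\zeta_{k-1}^\star(1)\}\\ &+\tfrac12\ln^2 2\,\{\zeta_{k-1}^\star(\bar2)-\zeta_{k-1}^\star(2)\}-\ln 2\,\{\zeta_{k-1}^\star(2,\bar1)-\zeta_{k-1}^\star(2,1)\}\\ &-\ln 2\,\{\zeta_{k-1}^\star(1,\bar2)-\zeta_{k-1}^\star(1,2)\} \end{aligned}\tag{1.7}$$ and $$\begin{aligned} \sum_{n=1}^\infty \frac{H_n^3}{n+k}(-1)^{n+k}={}&-\tfrac{5}{16}\zeta(4)+\tfrac98\zeta(3)\ln 2-\tfrac34\zeta(2)\ln^2 2+\tfrac14\ln^4 2+\tfrac98\zeta(3)\zeta_{k-1}^\star(\bar1)\\ &-\tfrac12\zeta(2)\zeta_{k-1}^\star(\bar2)-\zeta_{k-1}^\star(3,\bar1)+\tfrac32\zeta(2)\zeta_{k-1}^\star(1,\bar1)-\tfrac34\zeta(3)H_{k-1}\\ &+3\zeta_{k-1}^\star(1,2,\bar1)+3\zeta_{k-1}^\star(2,1,\bar1)-6\zeta_{k-1}^\star(1,1,1,\bar1)\\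 &+\ln 2\,\{\zeta_{k-1}^\star(\bar3)-\zeta_{k-1}^\star(3)\}-3\ln 2\,\{\zeta_{k-1}^\star(2,\bar1)-\zeta_{k-1}^\star(2,1)\}\\ &-3\ln 2\,\{\zeta_{k-1}^\star(1,\bar2)-\zeta_{k-1}^\star(1,2)\}+6\ln 2\,\{\zeta_{k-1}^\star(1,1,\bar1)-\zeta_{k-1}^\star(1,1,1)\}\\ &-3\ln^2 2\,\{\zeta_{k-1}^\star(1,\bar1)-\zeta_{k-1}^\star(1,1)\}+\tfrac32\ln^2 2\,\{\zeta_{k-1}^\star(\bar2)-\zeta_{k-1}^\star(2)\}\\ &+\{\ln^3 2-\tfrac32\ln 2\,\zeta(2)\}\{\zeta_{k-1}^\star(\bar1)-\zeta_{k-1}^\star(1)\}. \end{aligned}\tag{1.8}$$ -/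

import Mathlib

open Filter Topology Finset

noncomputable section

/-- The generalized harmonic number `H_n^{(m)} = ∑_{j=1}^n 1 / j^m`, as a real number. -/
def genHarmonic (m n : ℕ) : ℝ :=
  ∑ j ∈ Icc 1 n, 1 / (j : ℝ) ^ m

open Classical in
/-- The multiple harmonic star sum `ζ*_n(s_1, …, s_r)` for nonzero integers `s_1, …, s_r`: the sum
over all `n ≥ n_1 ≥ ⋯ ≥ n_r ≥ 1` of `∏_j sgn(s_j)^{n_j} / n_j^{|s_j|}`. A barred entry is a
negative one. -/
def starSum (n : ℕ) {r : ℕ} (s : Fin r → ℤ) : ℝ :=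
  ∑ m ∈ (Fintype.piFinset fun _ : Fin r => Icc 1 n) with Antitone m,
    ∏ j, ((s j).sign : ℝ) ^ m j / (m j : ℝ) ^ (s j).natAbs

/-- The value at a positive integer `p ≥ 2` of the Riemann zeta function, as a real number. -/
def zetaVal (p : ℕ) : ℝ :=
  (riemannZeta p).re

/-- `zetaVal p` is the sum of the series `∑_{n ≥ 1} 1 / n^p`. -/
theorem hasSum_zetaVal {p : ℕ} (hp : 1 < p) :
    HasSum (fun n : ℕ => 1 / ((n : ℝ) + 1) ^ p) (zetaVal p) := by
  have hs : Summable (fun n : ℕ => 1 / ((n : ℝ) + 1) ^ p) := by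
    have h := (summable_nat_add_iff 1).2 (Real.summable_one_div_nat_pow.2 hp)
    simpa using h
  have h2 : (riemannZeta p) = ((∑' n : ℕ, 1 / ((n : ℝ) + 1) ^ p : ℝ) : ℂ) := by
    rw [zeta_eq_tsum_one_div_nat_add_one_cpow (by simpa using hp)]
    push_cast
    refine tsum_congr fun n => ?_
    simp
  have h3 : zetaVal p = ∑' n : ℕ, 1 / ((n : ℝ) + 1) ^ p := by
    rw [zetaVal, h2, Complex.ofReal_re]
  rw [h3]
  exact hs.hasSum

end

/-! Each numerator is a quasi-shuffle combination of strict nested sums: `genHarmonic_one_mul_two`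
and `genHarmonic_one_pow_three` expand it in terms of `nest`. It remains to sum nested sums against
`(-1)^(n+k)/(n+k)`.

In the shift `k` these series obey a recursion: shifting the index replaces `nest p f` by its
increment `f n/(n+1)^p`, and partial fractions reduce that term to unshifted sums `altSum` and the
shifted series of `f`, which has smaller depth (`shiftedAltSum_nest_sub` and the `_succ` lemmas
after it). Star sums satisfy the same kind of recursion (`starSum_succ`), so they solve it; the
initial values supply the constants.

The initial values are alternating multiple zeta values. Shuffle identities between formal
polylogarithms, proved by differentiation, pass to the point `-1` by Abel's theorem and reduce them
to `log 2`, zeta values and one Euler sum, `tendsto_altSum_two_harmonic`. The weight-four values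
with index words (1,1,2) and (1,2,1) are found only through their sum, which is all that both
numerators need. -/

noncomputable section

/-! ### Nested sums: logarithmic growth and convergence of alternating series -/

/-- The strict nested sum `∑_{j=1}^n f (j-1) / j ^ p`. -/
def nest (p : ℕ) (f : ℕ → ℝ) (n : ℕ) : ℝ :=
  ∑ j ∈ range n, f j / ((j : ℝ) + 1) ^ p

/-- The constant sequence `1`, the empty nested sum. -/
def unitSeq : ℕ → ℝ := fun _ => 1

@[simp] lemma unitSeq_apply (n : ℕ) : unitSeq n = 1 := rfl

@[simp] lemma nest_zero (p : ℕ) (f : ℕ → ℝ) : nest p f 0 = 0 := by simp [nest]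

lemma nest_succ (p : ℕ) (f : ℕ → ℝ) (n : ℕ) :
    nest p f (n + 1) = nest p f n + f n / ((n : ℝ) + 1) ^ p := by
  simp [nest, sum_range_succ]

/-- Growth at most like a power of the logarithm, with the matching bound on the increments. -/
def LogRegular (r : ℕ) (f : ℕ → ℝ) : Prop :=
  ∀ n : ℕ, |f n| ≤ (1 + Real.log ((n : ℝ) + 1)) ^ r ∧
    |f (n + 1) - f n| ≤ (1 + Real.log ((n : ℝ) + 1)) ^ r / ((n : ℝ) + 1)

lemma one_le_one_add_log (n : ℕ) : 1 ≤ 1 + Real.log ((n : ℝ) + 1) := by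
  have : 0 ≤ Real.log ((n : ℝ) + 1) := Real.log_nonneg (by linarith [n.cast_nonneg (α := ℝ)])
  linarith

lemma sum_inv_le_one_add_log (n : ℕ) :
    ∑ j ∈ range n, 1 / ((j : ℝ) + 1) ≤ 1 + Real.log ((n : ℝ) + 1) := by
  have h := harmonic_le_one_add_log n
  have h2 : ((harmonic n : ℚ) : ℝ) = ∑ j ∈ range n, 1 / ((j : ℝ) + 1) := by
    simp [harmonic]
  rw [← h2]
  refine h.trans ?_
  rcases Nat.eq_zero_or_pos n with rfl | hn
  · simp
  · have : (0 : ℝ) < n := by exact_mod_cast hn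
    gcongr
    linarith

lemma logRegular_unitSeq : LogRegular 0 unitSeq := by
  intro n
  simp only [unitSeq_apply, abs_one, pow_zero, le_refl, sub_self, abs_zero, true_and]
  positivity

/-- Each nesting costs one factor of the logarithm, since the harmonic sum is at most `1 + log
(n+1)`. The increment bound is carried along because summation by parts needs it. -/
lemma LogRegular.nest {r : ℕ} {f : ℕ → ℝ} (hf : LogRegular r f) {p : ℕ} (hp : 1 ≤ p) :
    LogRegular (r + 1) (nest p f) := by
  have key : ∀ n : ℕ, |f n / ((n : ℝ) + 1) ^ p| ≤
      (1 + Real.log ((n : ℝ) + 1)) ^ r / ((n : ℝ) + 1) := by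
    intro n
    have hn : (1 : ℝ) ≤ (n : ℝ) + 1 := by linarith [n.cast_nonneg (α := ℝ)]
    rw [abs_div, abs_of_pos (by positivity : 0 < ((n : ℝ) + 1) ^ p)]
    have h1 : (n : ℝ) + 1 ≤ ((n : ℝ) + 1) ^ p := le_self_pow₀ hn (by omega)
    have h2 := (hf n).1
    have h3 := (abs_nonneg _).trans h2
    gcongr
  intro n
  constructor
  · have hl := one_le_one_add_log n
    calc |_root_.nest p f n| ≤ ∑ j ∈ range n, |f j / ((j : ℝ) + 1) ^ p| := abs_sum_le_sum_abs _ _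
      _ ≤ ∑ j ∈ range n, (1 + Real.log ((n : ℝ) + 1)) ^ r * (1 / ((j : ℝ) + 1)) := by
          refine sum_le_sum fun j hj => (key j).trans ?_
          rw [div_eq_mul_one_div]
          have := mem_range.1 hj
          have h3 := one_le_one_add_log j
          gcongr
      _ ≤ (1 + Real.log ((n : ℝ) + 1)) ^ r * (1 + Real.log ((n : ℝ) + 1)) := by
          rw [← mul_sum]
          exact mul_le_mul_of_nonneg_left (sum_inv_le_one_add_log n) (by positivity)
      _ = _ := (pow_succ _ _).symm
  · rw [nest_succ, add_sub_cancel_left]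
    refine (key n).trans ?_
    have hl := one_le_one_add_log n
    gcongr
    omega

lemma exists_log_pow_le (r : ℕ) :
    ∃ C : ℝ, ∀ n : ℕ, (1 + Real.log ((n : ℝ) + 1)) ^ r ≤ C * ((n : ℝ) + 1) ^ (1 / 2 : ℝ) := by
  -- From `log x ≤ x^ε/ε` with `ε = 1/(2(r+1))`: the `r`-th power then has exponent `r/(2(r+1)) ≤
  -- 1/2`.
  refine ⟨(1 + 2 * (r + 1)) ^ r, fun n => ?_⟩
  have hn : (1 : ℝ) ≤ (n : ℝ) + 1 := by linarith [n.cast_nonneg (α := ℝ)]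
  have hn0 : (0 : ℝ) ≤ (n : ℝ) + 1 := by linarith
  have he : (0 : ℝ) < 1 / (2 * (r + 1)) := by positivity
  have h1 := Real.log_le_rpow_div hn0 he
  have h2 : (1 : ℝ) ≤ ((n : ℝ) + 1) ^ (1 / (2 * ((r : ℝ) + 1))) := Real.one_le_rpow hn he.le
  have h3 : 1 + Real.log ((n : ℝ) + 1) ≤
      (1 + 2 * (r + 1)) * ((n : ℝ) + 1) ^ (1 / (2 * ((r : ℝ) + 1))) := by
    rw [div_div_eq_mul_div, div_one] at h1
    nlinarith
  calc (1 + Real.log ((n : ℝ) + 1)) ^ r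
      ≤ ((1 + 2 * (r + 1)) * ((n : ℝ) + 1) ^ (1 / (2 * ((r : ℝ) + 1)))) ^ r := by
        have := one_le_one_add_log n
        gcongr
    _ = (1 + 2 * (r + 1)) ^ r * ((n : ℝ) + 1) ^ (1 / (2 * ((r : ℝ) + 1)) * r) := by
        rw [mul_pow, Real.rpow_mul hn0, Real.rpow_natCast]
    _ ≤ _ := by
        refine mul_le_mul_of_nonneg_left (Real.rpow_le_rpow_of_exponent_le hn ?_) (by positivity)
        · rw [div_mul_eq_mul_div, one_mul, div_le_div_iff₀ (by positivity) (by norm_num)]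
          linarith

lemma summable_log_pow_div_sq (r : ℕ) :
    Summable fun n : ℕ => (1 + Real.log ((n : ℝ) + 1)) ^ r / ((n : ℝ) + 1) ^ 2 := by
  obtain ⟨C, hC⟩ := exists_log_pow_le r
  have hs : Summable fun n : ℕ => C * (1 / ((n : ℝ) + 1) ^ (3 / 2 : ℝ)) := by
    have h := (summable_nat_add_iff 1).2
      (Real.summable_one_div_nat_rpow.2 (by norm_num : (1 : ℝ) < 3 / 2))
    simp only [Nat.cast_add, Nat.cast_one] at h
    exact h.mul_left C
  refine hs.of_nonneg_of_le (fun n => ?_) (fun n => ?_)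
  · have := one_le_one_add_log n
    positivity
  · have hn : (0 : ℝ) < (n : ℝ) + 1 := by positivity
    rw [div_le_iff₀ (by positivity)]
    refine (hC n).trans (le_of_eq ?_)
    rw [mul_assoc, one_div_mul_eq_div, ← Real.rpow_natCast _ 2, ← Real.rpow_sub hn]
    norm_num

lemma tendsto_log_pow_div (r : ℕ) :
    Tendsto (fun n : ℕ => (1 + Real.log ((n : ℝ) + 1)) ^ r / ((n : ℝ) + 1)) atTop (𝓝 0) := by
  obtain ⟨C, hC⟩ := exists_log_pow_le r
  have h1 : Tendsto (fun n : ℕ => C * ((n : ℝ) + 1) ^ (-(1 / 2) : ℝ)) atTop (𝓝 (C * 0)) := by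
    refine Tendsto.const_mul _ ?_
    exact (tendsto_rpow_neg_atTop (by norm_num : (0 : ℝ) < 1 / 2)).comp
      (tendsto_atTop_add_const_right _ _ tendsto_natCast_atTop_atTop)
  rw [mul_zero] at h1
  refine squeeze_zero (fun n => ?_) (fun n => ?_) h1
  · have := one_le_one_add_log n
    positivity
  · have hn : (0 : ℝ) < (n : ℝ) + 1 := by positivity
    rw [div_le_iff₀ hn]
    refine (hC n).trans (le_of_eq ?_)
    nth_rewrite 3 [← Real.rpow_one ((n : ℝ) + 1)]
    rw [mul_assoc, ← Real.rpow_add hn]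
    norm_num

/-- An alternating series whose terms tend to zero with absolutely summable increments
converges. -/
lemma exists_tendsto_alternating {a : ℕ → ℝ} (h0 : Tendsto a atTop (𝓝 0))
    (hs : Summable fun n => |a (n + 1) - a n|) :
    ∃ s, Tendsto (fun N => ∑ n ∈ range N, (-1 : ℝ) ^ n * a n) atTop (𝓝 s) := by
  -- Summation by parts: averaging the sum with its shift leaves a boundary term and an absolutely
  -- convergent series of increments.
  have hid : ∀ N, ∑ n ∈ range N, (-1 : ℝ) ^ n * a n =
      (a 0 - (-1) ^ N * a N - ∑ n ∈ range N, (-1 : ℝ) ^ n * (a (n + 1) - a n)) / 2 := by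
    intro N
    induction N with
    | zero => simp
    | succ N ih => rw [sum_range_succ, sum_range_succ, ih]; ring
  have h1 : Summable fun n => (-1 : ℝ) ^ n * (a (n + 1) - a n) := by
    refine Summable.of_norm (hs.congr fun n => ?_)
    simp
  have h2 : Tendsto (fun N => (-1 : ℝ) ^ N * a N) atTop (𝓝 0) := by
    rw [tendsto_zero_iff_norm_tendsto_zero]
    simpa using h0.abs
  simp_rw [hid]
  exact ⟨_, ((tendsto_const_nhds.sub h2).sub h1.hasSum.tendsto_sum_nat).div_const 2⟩

/-- The partial sums of `∑_{m ≥ 1} (-1)^m f (m-1) / m ^ p`. -/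
def altSum (p : ℕ) (f : ℕ → ℝ) (N : ℕ) : ℝ :=
  ∑ n ∈ range N, f n * (-1) ^ (n + 1) / ((n : ℝ) + 1) ^ p

lemma LogRegular.summable_div_pow {r : ℕ} {f : ℕ → ℝ} (hf : LogRegular r f) {p : ℕ}
    (hp : 2 ≤ p) : Summable fun n : ℕ => |f n| / ((n : ℝ) + 1) ^ p := by
  refine (summable_log_pow_div_sq r).of_nonneg_of_le (fun n => by positivity) (fun n => ?_)
  have hn : (1 : ℝ) ≤ (n : ℝ) + 1 := by linarith [n.cast_nonneg (α := ℝ)]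
  have h2 := (hf n).1
  have h3 := (abs_nonneg _).trans h2
  gcongr

lemma LogRegular.exists_tendsto_altSum {r : ℕ} {f : ℕ → ℝ} (hf : LogRegular r f) {p : ℕ}
    (hp : 1 ≤ p) : ∃ s, Tendsto (altSum p f) atTop (𝓝 s) := by
  rcases hp.eq_or_lt with rfl | hp
  · obtain ⟨s, hs⟩ : ∃ s, Tendsto (fun N => ∑ n ∈ range N,
        (-1 : ℝ) ^ n * (f n / ((n : ℝ) + 1))) atTop (𝓝 s) := by
      refine exists_tendsto_alternating ?_ ?_
      · refine squeeze_zero_norm (fun n => ?_) (tendsto_log_pow_div r)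
        have hn : (0 : ℝ) < (n : ℝ) + 1 := by positivity
        rw [Real.norm_eq_abs, abs_div, abs_of_pos hn]
        have := (hf n).1
        gcongr
      · refine ((summable_log_pow_div_sq r).mul_left 2).of_nonneg_of_le
          (fun n => abs_nonneg _) (fun n => ?_)
        have hn : (0 : ℝ) < (n : ℝ) + 1 := by positivity
        obtain ⟨h1, h2⟩ := hf n
        set B := (1 + Real.log ((n : ℝ) + 1)) ^ r
        have hB : 0 ≤ B := (abs_nonneg _).trans h1
        have e : f (n + 1) / (((n + 1 : ℕ) : ℝ) + 1) - f n / ((n : ℝ) + 1) =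
            (f (n + 1) - f n) * (1 / ((n : ℝ) + 2)) +
              f n * (-(1 / (((n : ℝ) + 1) * ((n : ℝ) + 2)))) := by
          push_cast; field_simp; ring
        rw [e]
        refine (abs_add_le _ _).trans ?_
        rw [abs_mul, abs_mul, abs_neg, abs_of_pos (by positivity : 0 < 1 / ((n : ℝ) + 2)),
          abs_of_pos (by positivity : 0 < 1 / (((n : ℝ) + 1) * ((n : ℝ) + 2)))]
        have e1 : |f (n + 1) - f n| * (1 / ((n : ℝ) + 2)) ≤
            B / ((n : ℝ) + 1) * (1 / ((n : ℝ) + 1)) := by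
          gcongr; norm_num
        have e2 : |f n| * (1 / (((n : ℝ) + 1) * ((n : ℝ) + 2))) ≤
            B * (1 / (((n : ℝ) + 1) * ((n : ℝ) + 1))) := by
          gcongr; norm_num
        refine (add_le_add e1 e2).trans (le_of_eq ?_)
        field_simp; ring
    refine ⟨-s, hs.neg.congr fun N => ?_⟩
    rw [altSum, ← sum_neg_distrib]
    refine sum_congr rfl fun n _ => ?_
    rw [pow_one, pow_succ]; ring
  · have h : Summable fun n : ℕ => f n * (-1) ^ (n + 1) / ((n : ℝ) + 1) ^ p := by
      refine Summable.of_norm ((hf.summable_div_pow hp).congr fun n => ?_)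
      have hn : (0 : ℝ) < ((n : ℝ) + 1) ^ p := by positivity
      rw [Real.norm_eq_abs, abs_div, abs_mul, abs_of_pos hn]
      simp
    exact ⟨_, h.hasSum.tendsto_sum_nat⟩

/-! ### Formal polylogarithms and their shuffle identities -/

open PowerSeries in
/-- The formal series whose coefficients are the terms of the alternating series `altSum p f`. -/
def polylog (p : ℕ) (f : ℕ → ℝ) : PowerSeries ℝ := mk fun n => f (n - 1) / (n : ℝ) ^ p

open PowerSeries in
lemma derivative_polylog_one (f : ℕ → ℝ) : d⁄dX ℝ (polylog 1 f) = mk f := by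
  ext n
  rw [coeff_derivative, polylog, coeff_mk, coeff_mk]
  push_cast
  rw [pow_one, div_mul_cancel₀ _ (by positivity)]

open PowerSeries in
lemma X_mul_derivative_polylog_succ (p : ℕ) (f : ℕ → ℝ) (hp : 1 ≤ p) :
    X * d⁄dX ℝ (polylog (p + 1) f) = polylog p f := by
  ext n
  rcases n with _ | n
  · simp [polylog, show p ≠ 0 by omega]
  · rw [coeff_succ_X_mul, coeff_derivative, polylog, polylog, coeff_mk, coeff_mk]
    push_cast
    rw [pow_succ]
    field_simp

-- Taking partial sums is multiplication by `1/(1-X)`. This gives `polylog` its iterated-integral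
-- structure: derivatives strip off one index.
open PowerSeries in
lemma mk_nest (p : ℕ) (f : ℕ → ℝ) (hp : 1 ≤ p) :
    PowerSeries.mk (nest p f) = polylog p f * PowerSeries.mk unitSeq := by
  have h1 : PowerSeries.mk unitSeq * (1 - X) = (1 : PowerSeries ℝ) := mk_one_mul_one_sub_eq_one ℝ
  have h2 : PowerSeries.mk (nest p f) * (1 - X) = polylog p f := by
    ext n
    rw [mul_sub, mul_one, map_sub]
    rcases n with _ | n
    · simp [polylog, show p ≠ 0 by omega]
    · simp [polylog, coeff_succ_mul_X, nest_succ]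
  calc PowerSeries.mk (nest p f) = PowerSeries.mk (nest p f) * (PowerSeries.mk unitSeq * (1 - X)) := by rw [h1, mul_one]
    _ = (PowerSeries.mk (nest p f) * (1 - X)) * PowerSeries.mk unitSeq := by ring
    _ = _ := by rw [h2]

open PowerSeries in
lemma derivative_polylog_one_unitSeq :
    d⁄dX ℝ (polylog 1 unitSeq) = PowerSeries.mk unitSeq :=
  derivative_polylog_one _

open PowerSeries in
lemma derivative_polylog_one_nest (p : ℕ) (f : ℕ → ℝ) (hp : 1 ≤ p) :
    d⁄dX ℝ (polylog 1 (nest p f)) = polylog p f * PowerSeries.mk unitSeq := by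
  rw [derivative_polylog_one, mk_nest p f hp]

-- At index zero the coefficient is a division by `0 ^ p = 0`, which is zero by convention; this
-- uses `p ≠ 0`.
open PowerSeries in
lemma constantCoeff_polylog (p : ℕ) (f : ℕ → ℝ) (hp : 1 ≤ p) :
    constantCoeff (polylog p f) = 0 := by
  rw [← coeff_zero_eq_constantCoeff_apply]
  simp [polylog, show p ≠ 0 by omega]

open PowerSeries in
lemma eq_of_X_mul_derivative_eq {f g : PowerSeries ℝ} (h : X * d⁄dX ℝ f = X * d⁄dX ℝ g)
    (h0 : constantCoeff f = constantCoeff g) : f = g :=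
  derivative.ext (mul_left_cancel₀ X_ne_zero h) h0

section Shuffle

open PowerSeries

/-- Here and below both sides have constant term zero, so it suffices to compare derivatives (or `X`
times them); Leibniz leaves a shuffle identity of lower weight, or nothing. -/
lemma polylog_shuffle_1_1 :
    polylog 1 unitSeq * polylog 1 unitSeq = 2 * polylog 1 (nest 1 unitSeq) := by
  refine derivative.ext ?_ (by simp [constantCoeff_polylog])
  simp only [two_mul, map_add, Derivation.leibniz, smul_eq_mul, derivative_polylog_one_unitSeq,
    derivative_polylog_one_nest, le_refl]

lemma polylog_shuffle_1_11 :
    polylog 1 unitSeq * polylog 1 (nest 1 unitSeq) =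
      3 * polylog 1 (nest 1 (nest 1 unitSeq)) := by
  refine derivative.ext ?_ (by simp [constantCoeff_polylog])
  rw [show (3 : PowerSeries ℝ) = 1 + 1 + 1 by norm_num]
  simp only [add_mul, one_mul, map_add, Derivation.leibniz, smul_eq_mul, derivative_polylog_one_unitSeq,
    derivative_polylog_one_nest, le_refl]
  linear_combination PowerSeries.mk unitSeq * polylog_shuffle_1_1

lemma polylog_shuffle_1_111 :
    polylog 1 unitSeq * polylog 1 (nest 1 (nest 1 unitSeq)) =
      4 * polylog 1 (nest 1 (nest 1 (nest 1 unitSeq))) := by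
  refine derivative.ext ?_ (by simp [constantCoeff_polylog])
  rw [show (4 : PowerSeries ℝ) = 1 + 1 + 1 + 1 by norm_num]
  simp only [add_mul, one_mul, map_add, Derivation.leibniz, smul_eq_mul, derivative_polylog_one_unitSeq,
    derivative_polylog_one_nest, le_refl]
  linear_combination PowerSeries.mk unitSeq * polylog_shuffle_1_11

lemma polylog_shuffle_1_2 :
    polylog 1 unitSeq * polylog 2 unitSeq =
      polylog 1 (nest 2 unitSeq) + 2 * polylog 2 (nest 1 unitSeq) := by
  refine eq_of_X_mul_derivative_eq ?_ (by simp [constantCoeff_polylog])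
  simp only [two_mul, map_add, Derivation.leibniz, smul_eq_mul, derivative_polylog_one_unitSeq,
    derivative_polylog_one_nest, one_le_two]
  linear_combination polylog 1 unitSeq * X_mul_derivative_polylog_succ 1 unitSeq le_rfl -
    2 * X_mul_derivative_polylog_succ 1 (nest 1 unitSeq) le_rfl + polylog_shuffle_1_1

lemma polylog_shuffle_1_12 :
    polylog 1 unitSeq * polylog 1 (nest 2 unitSeq) =
      2 * (polylog 1 (nest 1 (nest 2 unitSeq)) + polylog 1 (nest 2 (nest 1 unitSeq))) := by
  refine derivative.ext ?_ (by simp [constantCoeff_polylog])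
  simp only [two_mul, map_add, Derivation.leibniz, smul_eq_mul, derivative_polylog_one_unitSeq,
    derivative_polylog_one_nest, one_le_two, le_refl]
  linear_combination PowerSeries.mk unitSeq * polylog_shuffle_1_2

/-- Integration by parts: subtracting the square cancels the products of the first and second
polylogarithms in the derivative, so no other depth-two polylogarithm enters. -/
lemma polylog_shuffle_13 :
    2 * (polylog 1 unitSeq * polylog 3 unitSeq) =
      polylog 2 unitSeq * polylog 2 unitSeq + 2 * polylog 1 (nest 3 unitSeq) := by
  refine eq_of_X_mul_derivative_eq ?_ (by simp [constantCoeff_polylog])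
  simp only [two_mul, map_add, Derivation.leibniz, smul_eq_mul, derivative_polylog_one_unitSeq,
    derivative_polylog_one_nest, (by norm_num : 1 ≤ 3)]
  linear_combination 2 * polylog 1 unitSeq * X_mul_derivative_polylog_succ 2 unitSeq one_le_two -
    2 * polylog 2 unitSeq * X_mul_derivative_polylog_succ 1 unitSeq le_rfl

end Shuffle

/-! ### Abel summation at `-1` -/

/-- Abel summability of a power series at `-1`. -/
def HasAbelSum (f : PowerSeries ℝ) (s : ℝ) : Prop :=
  (∀ x : ℝ, |x| < 1 → Summable fun n => ‖PowerSeries.coeff n f * (-1) ^ n * x ^ n‖) ∧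
    Tendsto (fun x : ℝ => ∑' n, PowerSeries.coeff n f * (-1) ^ n * x ^ n) (𝓝[<] 1) (𝓝 s)

lemma HasAbelSum.unique {f : PowerSeries ℝ} {s t : ℝ} (hs : HasAbelSum f s)
    (ht : HasAbelSum f t) : s = t :=
  tendsto_nhds_unique hs.2 ht.2

lemma eventually_abs_lt_one : ∀ᶠ x : ℝ in 𝓝[<] 1, |x| < 1 := by
  filter_upwards [self_mem_nhdsWithin,
    mem_nhdsWithin_of_mem_nhds (Ioi_mem_nhds (show (0 : ℝ) < 1 by norm_num))] with x hx hx'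
  rw [abs_of_pos hx']
  exact hx

lemma HasAbelSum.add {f g : PowerSeries ℝ} {s t : ℝ} (hs : HasAbelSum f s)
    (ht : HasAbelSum g t) : HasAbelSum (f + g) (s + t) := by
  have e : ∀ x : ℝ, ∀ n, PowerSeries.coeff n (f + g) * (-1) ^ n * x ^ n =
      PowerSeries.coeff n f * (-1) ^ n * x ^ n + PowerSeries.coeff n g * (-1) ^ n * x ^ n := by
    intro x n
    rw [map_add]; ring
  constructor
  · intro x hx
    simp_rw [e]
    exact ((hs.1 x hx).add (ht.1 x hx)).of_nonneg_of_le (fun n => norm_nonneg _)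
      (fun n => norm_add_le _ _)
  · refine (hs.2.add ht.2).congr' ?_
    filter_upwards [eventually_abs_lt_one] with x hx
    simp_rw [e]
    exact ((hs.1 x hx).of_norm.tsum_add (ht.1 x hx).of_norm).symm

/-- Cauchy products are legitimate inside the unit disc by absolute convergence, so the limit is
multiplicative even where the series at `-1` converge only conditionally. -/
lemma HasAbelSum.mul {f g : PowerSeries ℝ} {s t : ℝ} (hs : HasAbelSum f s)
    (ht : HasAbelSum g t) : HasAbelSum (f * g) (s * t) := by
  have e : ∀ x : ℝ, ∀ n, PowerSeries.coeff n (f * g) * (-1) ^ n * x ^ n =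
      ∑ kl ∈ antidiagonal n, (PowerSeries.coeff kl.1 f * (-1) ^ kl.1 * x ^ kl.1) *
        (PowerSeries.coeff kl.2 g * (-1) ^ kl.2 * x ^ kl.2) := by
    intro x n
    rw [PowerSeries.coeff_mul, sum_mul, sum_mul]
    refine sum_congr rfl fun kl hkl => ?_
    rw [← mem_antidiagonal.1 hkl, pow_add, pow_add]
    ring
  constructor
  · intro x hx
    simp_rw [e]
    exact summable_norm_sum_mul_antidiagonal_of_summable_norm
      (f := fun n => PowerSeries.coeff n f * (-1) ^ n * x ^ n)
      (g := fun n => PowerSeries.coeff n g * (-1) ^ n * x ^ n) (hs.1 x hx) (ht.1 x hx)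
  · refine (hs.2.mul ht.2).congr' ?_
    filter_upwards [eventually_abs_lt_one] with x hx
    simp_rw [e]
    exact tsum_mul_tsum_eq_tsum_sum_antidiagonal_of_summable_norm
      (f := fun n => PowerSeries.coeff n f * (-1) ^ n * x ^ n)
      (g := fun n => PowerSeries.coeff n g * (-1) ^ n * x ^ n) (hs.1 x hx) (ht.1 x hx)

/-- Abel's limit theorem for the series `altSum`. -/
lemma HasAbelSum.of_tendsto {p : ℕ} {f : ℕ → ℝ} {s : ℝ} (hp : 1 ≤ p)
    (h : Tendsto (altSum p f) atTop (𝓝 s)) : HasAbelSum (polylog p f) s := by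
  set a : ℕ → ℝ := fun n => PowerSeries.coeff n (polylog p f) * (-1) ^ n with ha
  have h1 : Tendsto (fun N => ∑ n ∈ range N, a n) atTop (𝓝 s) := by
    refine (tendsto_add_atTop_iff_nat 1).1 (h.congr fun N => ?_)
    rw [sum_range_succ', altSum]
    simp only [ha, polylog, PowerSeries.coeff_mk]
    simp only [CharP.cast_eq_zero, zero_pow (show p ≠ 0 by omega), div_zero, zero_mul, add_zero]
    refine sum_congr rfl fun n _ => ?_
    rw [Nat.add_sub_cancel]
    push_cast
    ring
  refine ⟨fun x hx => ?_, Real.tendsto_tsum_powerSeries_nhdsWithin_lt h1⟩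
  have h0 : Tendsto a atTop (𝓝 0) := by
    have := ((tendsto_add_atTop_iff_nat 1).2 h1).sub h1
    simpa [sum_range_succ] using this
  obtain ⟨C, hC⟩ := h0.abs.bddAbove_range
  refine ((summable_geometric_of_abs_lt_one (r := |x|) (by rwa [abs_abs])).mul_left
    C).of_nonneg_of_le (fun n => norm_nonneg _) (fun n => ?_)
  rw [norm_mul, norm_pow, Real.norm_eq_abs, Real.norm_eq_abs]
  exact mul_le_mul_of_nonneg_right (hC ⟨n, rfl⟩) (by positivity)

/-! ### Double series and Euler sums of weight three -/

lemma hasSum_of_eq {f g : ℕ → ℝ} {a : ℝ} (h : ∀ n, f n = g n) (hg : HasSum g a) : HasSum f a := by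
  rwa [funext h]

lemma hasSum_telescope {c : ℕ → ℝ} (hc : Antitone c) (h0 : Tendsto c atTop (𝓝 0)) (m : ℕ) :
    HasSum (fun k => c k - c (k + m)) (∑ k ∈ range m, c k) := by
  rw [hasSum_iff_tendsto_nat_of_nonneg fun k => sub_nonneg.2 (hc (Nat.le_add_right k m))]
  have e : ∀ N, ∑ k ∈ range N, (c k - c (k + m)) =
      ∑ k ∈ range m, c k - ∑ k ∈ range m, c (N + k) := by
    intro N
    have h1 := sum_range_add c N m
    have h2 := sum_range_add c m N
    rw [add_comm m N] at h2
    simp_rw [add_comm m] at h2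
    rw [sum_sub_distrib]
    linarith
  simp_rw [e]
  have h1 : Tendsto (fun N => ∑ k ∈ range m, c (N + k)) atTop (𝓝 (∑ k ∈ range m, (0 : ℝ))) :=
    tendsto_finsetSum _ fun k _ => (tendsto_add_atTop_iff_nat k).2 h0
  simpa using tendsto_const_nhds.sub h1

/-- Summing a nonnegative double series by rows and by antidiagonals. -/
lemma hasSum_antidiagonal_of_rows {G : ℕ × ℕ → ℝ} (hG : ∀ x, 0 ≤ G x) {R : ℕ → ℝ} {s : ℝ}
    (hR : ∀ n, HasSum (fun k => G (n, k)) (R n)) (hs : HasSum R s) :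
    HasSum (fun n => ∑ x ∈ antidiagonal n, G x) s := by
  have hsum : Summable G := by
    rw [summable_prod_of_nonneg hG]
    exact ⟨fun n => (hR n).summable, hs.summable.congr fun n => (hR n).tsum_eq.symm⟩
  have h1 : HasSum G s := by
    have := hsum.hasSum.prod_fiberwise hR
    rw [hs.unique this]
    exact hsum.hasSum
  have h2 := (HasAntidiagonal.sigmaAntidiagonalEquivProd (A := ℕ)).hasSum_iff.2 h1
  refine h2.sigma fun n => ?_
  have := hasSum_fintype (fun x : antidiagonal n => G x)
  rwa [univ_eq_attach, sum_attach (antidiagonal n) G] at this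

lemma sum_antidiagonal_add_apply (f g : ℕ → ℝ) (n : ℕ) :
    ∑ x ∈ antidiagonal n, (f x.1 + g x.2) =
      ∑ i ∈ range (n + 1), f i + ∑ i ∈ range (n + 1), g i := by
  rw [sum_add_distrib, Nat.sum_antidiagonal_eq_sum_range_succ (fun i _ => f i),
    Nat.sum_antidiagonal_eq_sum_range_succ (fun _ j => g j), ← sum_range_reflect g]
  simp

/-- The odd harmonic number `∑_{b < n} 1 / (2 b + 1)`. -/
def oddHarmonic (n : ℕ) : ℝ := ∑ b ∈ range n, 1 / (2 * (b : ℝ) + 1)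

lemma nest_one_two_mul (n : ℕ) :
    nest 1 unitSeq (2 * n) = oddHarmonic n + 1 / 2 * nest 1 unitSeq n := by
  induction n with
  | zero => simp [oddHarmonic]
  | succ n ih =>
    rw [show 2 * (n + 1) = 2 * n + 1 + 1 by ring, nest_succ, nest_succ, ih, oddHarmonic,
      oddHarmonic, sum_range_succ, nest_succ]
    simp only [unitSeq_apply, pow_one]
    push_cast
    field_simp
    ring

lemma tendsto_one_div_linear (u v : ℝ) (hu : 0 < u) :
    Tendsto (fun k : ℕ => 1 / (u * (k : ℝ) + v)) atTop (𝓝 0) := by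
  simp_rw [one_div]
  exact tendsto_inv_atTop_zero.comp
    (tendsto_atTop_add_const_right _ _ (tendsto_natCast_atTop_atTop.const_mul_atTop hu))

lemma antitone_one_div_linear (u v : ℝ) (hu : 0 < u) (hv : 0 < v) :
    Antitone (fun k : ℕ => 1 / (u * (k : ℝ) + v)) := by
  intro a b hab
  dsimp only
  gcongr

/-- `∑ H_n / (n+1)^2 = ζ(3)`. -/
lemma hasSum_harmonic_div_sq :
    HasSum (fun n : ℕ => nest 1 unitSeq n / ((n : ℝ) + 1) ^ 2) (zetaVal 3) := by
  have hsum : Summable fun n : ℕ => nest 1 unitSeq n / ((n : ℝ) + 1) ^ 2 := by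
    refine Summable.of_norm
      (((logRegular_unitSeq.nest le_rfl).summable_div_pow le_rfl).congr fun n => ?_)
    rw [Real.norm_eq_abs, abs_div, abs_of_pos (by positivity : 0 < ((n : ℝ) + 1) ^ 2)]
  obtain ⟨A, hA⟩ := hsum
  have h3 := hasSum_zetaVal (p := 3) (by norm_num)
  -- Symmetric kernel `1/(ab(a+b))` with `a, b ≥ 1`: rows total `A + ζ(3)` by telescoping,
  -- antidiagonals total `2A`, hence `A = ζ(3)`.
  have h := hasSum_antidiagonal_of_rows
    (G := fun x => 1 / (((x.1 : ℝ) + 1) * ((x.2 : ℝ) + 1) * ((x.1 : ℝ) + x.2 + 2)))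
    (fun x => by positivity)
    (R := fun n : ℕ => nest 1 unitSeq n / ((n : ℝ) + 1) ^ 2 + 1 / ((n : ℝ) + 1) ^ 3)
    (fun n => by
      have h1 := (hasSum_telescope (antitone_one_div_linear 1 1 one_pos one_pos)
        (tendsto_one_div_linear 1 1 one_pos) (n + 1)).div_const (((n : ℝ) + 1) ^ 2)
      have h2 : nest 1 unitSeq n / ((n : ℝ) + 1) ^ 2 + 1 / ((n : ℝ) + 1) ^ 3 =
          (∑ k ∈ range (n + 1), 1 / (1 * (k : ℝ) + 1)) / ((n : ℝ) + 1) ^ 2 := by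
        rw [sum_range_succ, nest]
        simp only [unitSeq_apply, pow_one, one_mul]
        field_simp
      rw [h2]
      refine hasSum_of_eq (fun k => ?_) h1
      push_cast
      field_simp
      ring) (hA.add h3)
  have h' : HasSum (fun n : ℕ => 2 * (nest 1 unitSeq (n + 1) / (((n + 1 : ℕ) : ℝ) + 1) ^ 2))
      (A + zetaVal 3) := by
    refine hasSum_of_eq (fun n => ?_) h
    have e : ∀ x ∈ antidiagonal n,
        1 / (((x.1 : ℝ) + 1) * ((x.2 : ℝ) + 1) * ((x.1 : ℝ) + x.2 + 2)) =
          (1 / ((x.1 : ℝ) + 1) + 1 / ((x.2 : ℝ) + 1)) / ((n : ℝ) + 2) ^ 2 := by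
      intro x hx
      rw [← mem_antidiagonal.1 hx]
      push_cast
      field_simp
      ring
    rw [sum_congr rfl e, ← sum_div, sum_antidiagonal_add_apply (fun i => 1 / ((i : ℝ) + 1))
      (fun i => 1 / ((i : ℝ) + 1)), nest]
    simp only [unitSeq_apply, pow_one]
    push_cast
    ring
  have h2 := (hasSum_nat_add_iff' 1).2 hA
  simp only [range_one, sum_singleton, nest_zero, zero_div, sub_zero] at h2
  have := (h2.mul_left 2).unique h'
  rwa [show zetaVal 3 = A by linarith]

/-- `∑_{m ≥ 1} (-1)^m H_{m-1} / m^2 = ζ(3) / 8`. -/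
lemma tendsto_altSum_two_harmonic :
    Tendsto (altSum 2 (nest 1 unitSeq)) atTop (𝓝 (zetaVal 3 / 8)) := by
  set a : ℕ → ℝ := fun n => nest 1 unitSeq n / ((n : ℝ) + 1) ^ 2 with ha
  have hA : HasSum a (zetaVal 3) := hasSum_harmonic_div_sq
  obtain ⟨E, hE⟩ : Summable fun n => a (2 * n) :=
    hA.summable.comp_injective (mul_right_injective₀ two_ne_zero)
  obtain ⟨O, hO⟩ : Summable fun n => a (2 * n + 1) :=
    hA.summable.comp_injective ((add_left_injective 1).comp (mul_right_injective₀ two_ne_zero))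
  -- Splitting `H_{2n+1}` into odd and even denominators; the even part contributes
  -- `(1/2)(1/4)ζ(3)`.
  have hX : HasSum (fun n : ℕ => oddHarmonic (n + 1) / (2 * (n : ℝ) + 2) ^ 2)
      (O - zetaVal 3 / 8) := by
    refine hasSum_of_eq (fun n => ?_) (hO.sub (hA.div_const 8))
    simp only [ha]
    have e : nest 1 unitSeq (2 * n + 1) =
        oddHarmonic (n + 1) + 1 / 2 * nest 1 unitSeq n := by
      rw [nest_succ, nest_one_two_mul, oddHarmonic, oddHarmonic, sum_range_succ]
      simp only [unitSeq_apply, pow_one]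
      push_cast
      ring
    rw [e]
    push_cast
    field_simp
    ring
  -- The kernel `1/(ab(a+b))` again, now with `a` even and `b` odd. Rows give the series `hX`;
  -- antidiagonals give the even-indexed terms `a (2n+2)`, so `E = O - ζ(3)/8`.
  have h := hasSum_antidiagonal_of_rows
    (G := fun x => 1 / ((2 * (x.1 : ℝ) + 2) * (2 * (x.2 : ℝ) + 1) * (2 * (x.1 : ℝ) + 2 * x.2 + 3)))
    (fun x => by positivity)
    (fun n => by
      have h1 := (hasSum_telescope (antitone_one_div_linear 2 1 two_pos one_pos)
        (tendsto_one_div_linear 2 1 two_pos) (n + 1)).div_const ((2 * (n : ℝ) + 2) ^ 2)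
      refine hasSum_of_eq (fun k => ?_) h1
      push_cast
      field_simp
      ring) hX
  have hE' : HasSum (fun n : ℕ => a (2 * (n + 1))) (O - zetaVal 3 / 8) := by
    refine hasSum_of_eq (fun n => ?_) h
    have e : ∀ x ∈ antidiagonal n,
        1 / ((2 * (x.1 : ℝ) + 2) * (2 * (x.2 : ℝ) + 1) * (2 * (x.1 : ℝ) + 2 * x.2 + 3)) =
          (1 / (2 * (x.1 : ℝ) + 2) + 1 / (2 * (x.2 : ℝ) + 1)) / (2 * (n : ℝ) + 3) ^ 2 := by
      intro x hx
      rw [← mem_antidiagonal.1 hx]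
      push_cast
      field_simp
      ring
    rw [sum_congr rfl e, ← sum_div, sum_antidiagonal_add_apply (fun i => 1 / (2 * (i : ℝ) + 2))
      (fun i => 1 / (2 * (i : ℝ) + 1)), ha]
    simp only [nest_one_two_mul]
    rw [oddHarmonic, nest, mul_sum, add_comm]
    simp only [unitSeq_apply, pow_one]
    congr 1
    · congr 1
      refine sum_congr rfl fun i _ => ?_
      field_simp
    · push_cast; ring
  have h2 := (hasSum_nat_add_iff' 1).2 hE
  simp only [range_one, sum_singleton, mul_zero, ha, nest_zero, zero_div, sub_zero] at h2
  have hEO : E = O - zetaVal 3 / 8 := h2.unique hE'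
  have hfin : HasSum (fun n : ℕ => nest 1 unitSeq n * (-1) ^ (n + 1) / ((n : ℝ) + 1) ^ 2)
      (-E + O) := by
    refine HasSum.even_add_odd ?_ ?_
    · refine hasSum_of_eq (fun n => ?_) hE.neg
      simp [ha, pow_succ, pow_mul, neg_div]
    · refine hasSum_of_eq (fun n => ?_) hO
      simp [ha, pow_succ, pow_mul]
  rw [show zetaVal 3 / 8 = -E + O by rw [hEO]; ring]
  exact hfin.tendsto_sum_nat

/-! ### Values of the unshifted alternating sums -/

lemma tendsto_altSum_one_unitSeq : Tendsto (altSum 1 unitSeq) atTop (𝓝 (-Real.log 2)) := by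
  obtain ⟨s, hs⟩ := logRegular_unitSeq.exists_tendsto_altSum le_rfl
  have h1 := (HasAbelSum.of_tendsto le_rfl hs).2
  have h2 : Tendsto (fun x : ℝ => -Real.log (1 + x)) (𝓝[<] 1) (𝓝 (-Real.log (1 + 1))) := by
    refine Tendsto.mono_left ?_ nhdsWithin_le_nhds
    exact (((continuousAt_const.add continuousAt_id).log (by norm_num)).neg).tendsto
  have h3 : s = -Real.log 2 := by
    rw [one_add_one_eq_two] at h2
    refine tendsto_nhds_unique (h1.congr' ?_) h2
    filter_upwards [eventually_abs_lt_one] with x hx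
    have h4 := Real.hasSum_pow_div_log_of_abs_lt_one (x := -x) (by rwa [abs_neg])
    rw [sub_neg_eq_add] at h4
    have h5 : HasSum (fun n => PowerSeries.coeff n (polylog 1 unitSeq) * (-1) ^ n * x ^ n)
        (-Real.log (1 + x)) := by
      refine (hasSum_nat_add_iff' 1).1 ?_
      rw [range_one, sum_singleton, polylog, PowerSeries.coeff_mk, Nat.cast_zero, pow_one,
        div_zero, zero_mul, zero_mul, sub_zero]
      refine hasSum_of_eq (fun n => ?_) h4
      rw [PowerSeries.coeff_mk, unitSeq_apply, neg_pow x]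
      push_cast
      ring
    exact h5.tsum_eq
  rwa [h3] at hs

lemma tendsto_altSum_unitSeq {p : ℕ} (hp : 2 ≤ p) :
    Tendsto (altSum p unitSeq) atTop (𝓝 ((2 / 2 ^ p - 1) * zetaVal p)) := by
  have hz := hasSum_zetaVal (p := p) hp
  set a : ℕ → ℝ := fun n => 1 / ((n : ℝ) + 1) ^ p with ha
  have hO : HasSum (fun n => a (2 * n + 1)) (zetaVal p / 2 ^ p) := by
    refine hasSum_of_eq (fun n => ?_) (hz.div_const (2 ^ p))
    simp only [ha]
    rw [div_div, ← mul_pow]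
    push_cast
    ring_nf
  obtain ⟨E, hE⟩ : Summable fun n => a (2 * n) :=
    hz.summable.comp_injective (mul_right_injective₀ two_ne_zero)
  have hEO := (hE.even_add_odd hO).unique hz
  have hfin : HasSum (fun n : ℕ => unitSeq n * (-1) ^ (n + 1) / ((n : ℝ) + 1) ^ p)
      (-E + zetaVal p / 2 ^ p) := by
    refine HasSum.even_add_odd ?_ ?_
    · refine hasSum_of_eq (fun n => ?_) hE.neg
      simp [ha, pow_succ, pow_mul, neg_div]
    · refine hasSum_of_eq (fun n => ?_) hO
      simp [ha, pow_succ, pow_mul]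
  rw [show (2 / 2 ^ p - 1) * zetaVal p = -E + zetaVal p / 2 ^ p by linear_combination hEO]
  exact hfin.tendsto_sum_nat

lemma tendsto_altSum_two_unitSeq :
    Tendsto (altSum 2 unitSeq) atTop (𝓝 (-(zetaVal 2 / 2))) := by
  convert tendsto_altSum_unitSeq (p := 2) le_rfl using 2
  ring

lemma tendsto_altSum_three_unitSeq :
    Tendsto (altSum 3 unitSeq) atTop (𝓝 (-(3 / 4 * zetaVal 3))) := by
  convert tendsto_altSum_unitSeq (p := 3) (by norm_num) using 2
  ring

/-- Converts the square of the second polylogarithm's value in `polylog_shuffle_13` into `ζ(4)`. -/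
lemma zetaVal_two_sq : zetaVal 2 ^ 2 = 5 / 2 * zetaVal 4 := by
  have h2 : zetaVal 2 = Real.pi ^ 2 / 6 := by
    rw [zetaVal, Nat.cast_ofNat, riemannZeta_two]
    norm_cast
  have h4 : zetaVal 4 = Real.pi ^ 4 / 90 := by
    rw [zetaVal, Nat.cast_ofNat, riemannZeta_four]
    norm_cast
  rw [h2, h4]
  ring

lemma HasAbelSum.two_mul {f : PowerSeries ℝ} {s : ℝ} (h : HasAbelSum f s) :
    HasAbelSum (2 * f) (2 * s) := by
  simpa only [_root_.two_mul] using h.add h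

/-- The pattern for the values below: log-regularity gives convergence to some limit, and uniqueness
of Abel sums in a shuffle identity identifies it. -/
lemma tendsto_altSum_11 :
    Tendsto (altSum 1 (nest 1 unitSeq)) atTop (𝓝 (Real.log 2 ^ 2 / 2)) := by
  obtain ⟨s, hs⟩ := (logRegular_unitSeq.nest le_rfl).exists_tendsto_altSum (p := 1) le_rfl
  have h1 := HasAbelSum.of_tendsto le_rfl tendsto_altSum_one_unitSeq
  have h2 := (HasAbelSum.of_tendsto le_rfl hs).two_mul
  rw [← polylog_shuffle_1_1] at h2
  have := h2.unique (h1.mul h1)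
  rwa [show Real.log 2 ^ 2 / 2 = s by linarith]

lemma tendsto_altSum_111 :
    Tendsto (altSum 1 (nest 1 (nest 1 unitSeq))) atTop (𝓝 (-(Real.log 2 ^ 3 / 6))) := by
  obtain ⟨s, hs⟩ :=
    ((logRegular_unitSeq.nest le_rfl).nest le_rfl).exists_tendsto_altSum (p := 1) le_rfl
  have h1 := HasAbelSum.of_tendsto le_rfl tendsto_altSum_one_unitSeq
  have h2 := HasAbelSum.of_tendsto le_rfl tendsto_altSum_11
  have h3 := HasAbelSum.of_tendsto le_rfl hs
  have h4 := (h3.add h3).add h3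
  rw [show ∀ f : PowerSeries ℝ, f + f + f = 3 * f by intro f; ring, ← polylog_shuffle_1_11] at h4
  have := h4.unique (h1.mul h2)
  rwa [show -(Real.log 2 ^ 3 / 6) = s by linarith]

lemma tendsto_altSum_1111 :
    Tendsto (altSum 1 (nest 1 (nest 1 (nest 1 unitSeq)))) atTop (𝓝 (Real.log 2 ^ 4 / 24)) := by
  obtain ⟨s, hs⟩ := (((logRegular_unitSeq.nest le_rfl).nest le_rfl).nest
    le_rfl).exists_tendsto_altSum (p := 1) le_rfl
  have h1 := HasAbelSum.of_tendsto le_rfl tendsto_altSum_one_unitSeq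
  have h2 := HasAbelSum.of_tendsto le_rfl tendsto_altSum_111
  have h3 := (HasAbelSum.of_tendsto le_rfl hs).two_mul.two_mul
  rw [show ∀ f : PowerSeries ℝ, 2 * (2 * f) = 4 * f by intro f; ring,
    ← polylog_shuffle_1_111] at h3
  have := h3.unique (h1.mul h2)
  rwa [show Real.log 2 ^ 4 / 24 = s by linarith]

lemma tendsto_altSum_12 :
    Tendsto (altSum 1 (nest 2 unitSeq)) atTop
      (𝓝 (zetaVal 2 * Real.log 2 / 2 - zetaVal 3 / 4)) := by
  obtain ⟨s, hs⟩ := (logRegular_unitSeq.nest one_le_two).exists_tendsto_altSum (p := 1) le_rfl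
  have h1 := HasAbelSum.of_tendsto le_rfl tendsto_altSum_one_unitSeq
  have h2 := HasAbelSum.of_tendsto one_le_two tendsto_altSum_two_unitSeq
  have h3 := HasAbelSum.of_tendsto one_le_two tendsto_altSum_two_harmonic
  have h4 := (HasAbelSum.of_tendsto le_rfl hs).add h3.two_mul
  rw [← polylog_shuffle_1_2] at h4
  have := h4.unique (h1.mul h2)
  rwa [show zetaVal 2 * Real.log 2 / 2 - zetaVal 3 / 4 = s by linarith]

lemma exists_tendsto_altSum_112_121 :
    ∃ s t, Tendsto (altSum 1 (nest 1 (nest 2 unitSeq))) atTop (𝓝 s) ∧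
      Tendsto (altSum 1 (nest 2 (nest 1 unitSeq))) atTop (𝓝 t) ∧
      s + t = zetaVal 3 * Real.log 2 / 8 - zetaVal 2 * Real.log 2 ^ 2 / 4 := by
  obtain ⟨s, hs⟩ := ((logRegular_unitSeq.nest one_le_two).nest le_rfl).exists_tendsto_altSum
    (p := 1) le_rfl
  obtain ⟨t, ht⟩ := ((logRegular_unitSeq.nest le_rfl).nest one_le_two).exists_tendsto_altSum
    (p := 1) le_rfl
  refine ⟨s, t, hs, ht, ?_⟩
  have h1 := HasAbelSum.of_tendsto le_rfl tendsto_altSum_one_unitSeq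
  have h2 := HasAbelSum.of_tendsto le_rfl tendsto_altSum_12
  have h4 := ((HasAbelSum.of_tendsto le_rfl hs).add (HasAbelSum.of_tendsto le_rfl ht)).two_mul
  rw [← polylog_shuffle_1_12] at h4
  have := h4.unique (h1.mul h2)
  linarith

lemma tendsto_altSum_13 :
    Tendsto (altSum 1 (nest 3 unitSeq)) atTop
      (𝓝 (3 / 4 * zetaVal 3 * Real.log 2 - 5 / 16 * zetaVal 4)) := by
  obtain ⟨s, hs⟩ := (logRegular_unitSeq.nest (by norm_num : 1 ≤ 3)).exists_tendsto_altSum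
    (p := 1) le_rfl
  have h1 := HasAbelSum.of_tendsto le_rfl tendsto_altSum_one_unitSeq
  have h2 := HasAbelSum.of_tendsto one_le_two tendsto_altSum_two_unitSeq
  have h3 := HasAbelSum.of_tendsto (by norm_num) tendsto_altSum_three_unitSeq
  have h4 := (h2.mul h2).add (HasAbelSum.of_tendsto le_rfl hs).two_mul
  rw [← polylog_shuffle_13] at h4
  have := h4.unique (h1.mul h3).two_mul
  have := zetaVal_two_sq
  rwa [show 3 / 4 * zetaVal 3 * Real.log 2 - 5 / 16 * zetaVal 4 = s by linarith]

/-! ### Recursions for star sums and harmonic numbers -/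

lemma starSum_vecEmpty (n : ℕ) : starSum n ![] = 1 := by
  rw [starSum, filter_true_of_mem (fun _ _ i => i.elim0)]
  simp

lemma starSum_zero {r : ℕ} (s : ℤ) (w : Fin r → ℤ) : starSum 0 (Matrix.vecCons s w) = 0 := by
  rw [starSum]
  refine sum_eq_zero fun m hm => ?_
  have := Fintype.mem_piFinset.1 (mem_filter.1 hm).1 0
  simp at this

/-- Peels off the largest index `m 0`; antitonicity turns it into the upper bound for the tail. -/
lemma starSum_vecCons {r : ℕ} (n : ℕ) (s : ℤ) (w : Fin r → ℤ) :
    starSum n (Matrix.vecCons s w) =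
      ∑ j ∈ Icc 1 n, (s.sign : ℝ) ^ j / (j : ℝ) ^ s.natAbs * starSum j w := by
  classical
  simp only [starSum, mul_sum]
  rw [sum_sigma']
  refine sum_bij' (fun m _ => ⟨m 0, Fin.tail m⟩) (fun x _ => Fin.cons x.1 x.2) ?_ ?_ ?_ ?_ ?_
  · intro m hm
    obtain ⟨h1, h2⟩ := mem_filter.1 hm
    rw [Fintype.mem_piFinset] at h1
    refine mem_sigma.2 ⟨h1 0, mem_filter.2 ⟨Fintype.mem_piFinset.2 fun i => ?_, fun i j hij => ?_⟩⟩
    · exact mem_Icc.2 ⟨(mem_Icc.1 (h1 i.succ)).1, h2 (Fin.zero_le _)⟩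
    · exact h2 (Fin.succ_le_succ_iff.2 hij)
  · rintro ⟨j, m⟩ hm
    obtain ⟨h0, h1⟩ := mem_sigma.1 hm
    obtain ⟨h1, h2⟩ := mem_filter.1 h1
    rw [Fintype.mem_piFinset] at h1
    dsimp only at h0 h1 h2 ⊢
    refine mem_filter.2 ⟨Fintype.mem_piFinset.2 fun i => ?_, fun i k hik => ?_⟩
    · refine Fin.cases ?_ (fun i => ?_) i
      · exact h0
      · rw [Fin.cons_succ]
        exact mem_Icc.2 ⟨(mem_Icc.1 (h1 i)).1, (mem_Icc.1 (h1 i)).2.trans (mem_Icc.1 h0).2⟩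
    · induction k using Fin.cases with
      | zero => rw [Fin.le_zero_iff.1 hik]
      | succ k =>
        induction i using Fin.cases with
        | zero => exact (mem_Icc.1 (h1 k)).2
        | succ i => exact h2 (Fin.succ_le_succ_iff.1 hik)
  · intro m _
    exact Fin.cons_self_tail m
  · rintro ⟨j, m⟩ _
    simp
  · intro m _
    rw [Fin.prod_univ_succ]
    rfl

lemma starSum_succ {r : ℕ} (n : ℕ) (s : ℤ) (w : Fin r → ℤ) :
    starSum (n + 1) (Matrix.vecCons s w) = starSum n (Matrix.vecCons s w) +
      (s.sign : ℝ) ^ (n + 1) / ((n : ℝ) + 1) ^ s.natAbs * starSum (n + 1) w := by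
  rw [starSum_vecCons, starSum_vecCons, sum_Icc_succ_top (by omega)]
  push_cast
  rfl

lemma genHarmonic_succ (m n : ℕ) :
    genHarmonic m (n + 1) = genHarmonic m n + 1 / ((n : ℝ) + 1) ^ m := by
  rw [genHarmonic, genHarmonic, sum_Icc_succ_top (by omega)]
  push_cast
  rfl

/-! ### Recursion in the shift -/

/-- The partial sums of `∑_n f n (-1)^(n+k+1) / (n+k+1)`. -/
def shiftedAltSum (f : ℕ → ℝ) (k N : ℕ) : ℝ :=
  ∑ n ∈ range N, f n * (-1) ^ (n + (k + 1)) / ((n : ℝ) + ((k : ℝ) + 1))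

lemma shiftedAltSum_zero (f : ℕ → ℝ) : shiftedAltSum f 0 = altSum 1 f := by
  ext N
  simp [shiftedAltSum, altSum]

/-- The term at index zero vanishes, so dropping it and reindexing aligns `N + 1` terms with `N`;
only the increments of `nest` survive. -/
lemma shiftedAltSum_nest_sub (p : ℕ) (f : ℕ → ℝ) (k N : ℕ) :
    shiftedAltSum (nest p f) k (N + 1) - shiftedAltSum (nest p f) (k + 1) N =
      ∑ n ∈ range N, f n / ((n : ℝ) + 1) ^ p * (-1) ^ (n + (k + 2)) /
        ((n : ℝ) + ((k : ℝ) + 2)) := by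
  rw [shiftedAltSum, sum_range_succ', nest_zero, zero_mul, zero_div, add_zero, shiftedAltSum,
    ← sum_sub_distrib]
  refine sum_congr rfl fun n _ => ?_
  rw [nest_succ, show n + 1 + (k + 1) = n + (k + 2) by ring,
    show n + (k + 1 + 1) = n + (k + 2) by ring]
  push_cast
  rw [show (n : ℝ) + 1 + (k + 1) = n + (k + 2) by ring,
    show (n : ℝ) + (k + 1 + 1) = n + (k + 2) by ring]
  ring

lemma tendsto_shiftedAltSum_unitSeq (k : ℕ) :
    Tendsto (shiftedAltSum unitSeq k) atTop (𝓝 (-Real.log 2 - starSum k ![-1])) := by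
  induction k with
  | zero =>
    rw [shiftedAltSum_zero, starSum_zero, sub_zero]
    exact tendsto_altSum_one_unitSeq
  | succ k ih =>
    have h := (tendsto_add_atTop_iff_nat 1).2 ih
    have h2 := h.sub_const ((-1) ^ (k + 1) / ((k : ℝ) + 1))
    rw [starSum_succ, starSum_vecEmpty]
    convert h2 using 2 with N
    · rw [shiftedAltSum, shiftedAltSum, sum_range_succ']
      simp only [unitSeq_apply, CharP.cast_eq_zero, zero_add, one_mul, add_sub_cancel_right]
      refine sum_congr rfl fun n _ => ?_
      push_cast
      rw [show n + 1 + (k + 1) = n + (k + 1 + 1) by ring,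
        show (n : ℝ) + 1 + (k + 1) = n + (k + 1 + 1) by ring]
    · simp
      ring

/-- Partial fractions with `x = n+1`, `y = n+k+2`, `y - x = k+1`: `1/(xy) = (1/x - 1/y)/(k+1)`. The
next two lemmas iterate this for `1/(x^2 y)` and `1/(x^3 y)`. -/
lemma tendsto_shiftedAltSum_nest_one_succ {f : ℕ → ℝ} {k : ℕ} {a b z₁ : ℝ}
    (h₁ : Tendsto (altSum 1 f) atTop (𝓝 z₁))
    (ha : Tendsto (shiftedAltSum (nest 1 f) k) atTop (𝓝 a))
    (hb : Tendsto (shiftedAltSum f (k + 1)) atTop (𝓝 b)) :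
    Tendsto (shiftedAltSum (nest 1 f) (k + 1)) atTop
      (𝓝 (a - ((-1) ^ (k + 1) * z₁ - b) / ((k : ℝ) + 1))) := by
  have h := ((tendsto_add_atTop_iff_nat 1).2 ha).sub
    (((h₁.const_mul ((-1) ^ (k + 1))).sub hb).div_const ((k : ℝ) + 1))
  refine h.congr fun N => ?_
  rw [sub_eq_iff_eq_add', ← sub_eq_iff_eq_add, shiftedAltSum_nest_sub, altSum, shiftedAltSum,
    mul_sum, ← sum_sub_distrib, sum_div]
  refine sum_congr rfl fun n _ => ?_
  push_cast
  simp only [pow_add]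
  field_simp
  ring

lemma tendsto_shiftedAltSum_nest_two_succ {f : ℕ → ℝ} {k : ℕ} {a b z₁ z₂ : ℝ}
    (h₁ : Tendsto (altSum 1 f) atTop (𝓝 z₁)) (h₂ : Tendsto (altSum 2 f) atTop (𝓝 z₂))
    (ha : Tendsto (shiftedAltSum (nest 2 f) k) atTop (𝓝 a))
    (hb : Tendsto (shiftedAltSum f (k + 1)) atTop (𝓝 b)) :
    Tendsto (shiftedAltSum (nest 2 f) (k + 1)) atTop
      (𝓝 (a - ((-1) ^ (k + 1) * z₂ / ((k : ℝ) + 1) -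
        ((-1) ^ (k + 1) * z₁ - b) / ((k : ℝ) + 1) ^ 2))) := by
  have h := ((tendsto_add_atTop_iff_nat 1).2 ha).sub
    (((h₂.const_mul ((-1) ^ (k + 1))).div_const ((k : ℝ) + 1)).sub
      (((h₁.const_mul ((-1) ^ (k + 1))).sub hb).div_const (((k : ℝ) + 1) ^ 2)))
  refine h.congr fun N => ?_
  rw [sub_eq_iff_eq_add', ← sub_eq_iff_eq_add, shiftedAltSum_nest_sub, altSum, altSum,
    shiftedAltSum, mul_sum, mul_sum, ← sum_sub_distrib, sum_div, sum_div, ← sum_sub_distrib]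
  refine sum_congr rfl fun n _ => ?_
  push_cast
  simp only [pow_add]
  field_simp
  ring

lemma tendsto_shiftedAltSum_nest_three_succ {f : ℕ → ℝ} {k : ℕ} {a b z₁ z₂ z₃ : ℝ}
    (h₁ : Tendsto (altSum 1 f) atTop (𝓝 z₁)) (h₂ : Tendsto (altSum 2 f) atTop (𝓝 z₂))
    (h₃ : Tendsto (altSum 3 f) atTop (𝓝 z₃))
    (ha : Tendsto (shiftedAltSum (nest 3 f) k) atTop (𝓝 a))
    (hb : Tendsto (shiftedAltSum f (k + 1)) atTop (𝓝 b)) :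
    Tendsto (shiftedAltSum (nest 3 f) (k + 1)) atTop
      (𝓝 (a - ((-1) ^ (k + 1) * z₃ / ((k : ℝ) + 1) - ((-1) ^ (k + 1) * z₂ / ((k : ℝ) + 1) ^ 2 -
        ((-1) ^ (k + 1) * z₁ - b) / ((k : ℝ) + 1) ^ 3)))) := by
  have h := ((tendsto_add_atTop_iff_nat 1).2 ha).sub
    (((h₃.const_mul ((-1) ^ (k + 1))).div_const ((k : ℝ) + 1)).sub
      (((h₂.const_mul ((-1) ^ (k + 1))).div_const (((k : ℝ) + 1) ^ 2)).sub
        (((h₁.const_mul ((-1) ^ (k + 1))).sub hb).div_const (((k : ℝ) + 1) ^ 3))))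
  refine h.congr fun N => ?_
  rw [sub_eq_iff_eq_add', ← sub_eq_iff_eq_add, shiftedAltSum_nest_sub, altSum, altSum, altSum,
    shiftedAltSum, mul_sum, mul_sum, mul_sum, ← sum_sub_distrib, sum_div, sum_div, sum_div,
    ← sum_sub_distrib, ← sum_sub_distrib]
  refine sum_congr rfl fun n _ => ?_
  push_cast
  simp only [pow_add]
  field_simp
  ring

/-- Verification form: a proposed closed form `c` need only match the initial value and the
recursion. -/
lemma tendsto_shiftedAltSum_nest_one {f : ℕ → ℝ} {z₁ : ℝ} {c σ : ℕ → ℝ}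
    (h₁ : Tendsto (altSum 1 f) atTop (𝓝 z₁))
    (hf : ∀ k, Tendsto (shiftedAltSum f k) atTop (𝓝 (σ k)))
    (h₀ : Tendsto (altSum 1 (nest 1 f)) atTop (𝓝 (c 0)))
    (hc : ∀ k : ℕ, c (k + 1) = c k - ((-1) ^ (k + 1) * z₁ - σ (k + 1)) / ((k : ℝ) + 1)) (k : ℕ) :
    Tendsto (shiftedAltSum (nest 1 f) k) atTop (𝓝 (c k)) := by
  induction k with
  | zero => rwa [shiftedAltSum_zero]
  | succ k ih =>
    rw [hc]
    exact tendsto_shiftedAltSum_nest_one_succ h₁ ih (hf _)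

lemma tendsto_shiftedAltSum_nest_two {f : ℕ → ℝ} {z₁ z₂ : ℝ} {c σ : ℕ → ℝ}
    (h₁ : Tendsto (altSum 1 f) atTop (𝓝 z₁)) (h₂ : Tendsto (altSum 2 f) atTop (𝓝 z₂))
    (hf : ∀ k, Tendsto (shiftedAltSum f k) atTop (𝓝 (σ k)))
    (h₀ : Tendsto (altSum 1 (nest 2 f)) atTop (𝓝 (c 0)))
    (hc : ∀ k : ℕ, c (k + 1) = c k - ((-1) ^ (k + 1) * z₂ / ((k : ℝ) + 1) -
        ((-1) ^ (k + 1) * z₁ - σ (k + 1)) / ((k : ℝ) + 1) ^ 2)) (k : ℕ) :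
    Tendsto (shiftedAltSum (nest 2 f) k) atTop (𝓝 (c k)) := by
  induction k with
  | zero => rwa [shiftedAltSum_zero]
  | succ k ih =>
    rw [hc]
    exact tendsto_shiftedAltSum_nest_two_succ h₁ h₂ ih (hf _)

/-! ### Closed forms for the shifted sums -/

section ClosedForms

local notation "ℓ" => Real.log 2

lemma tendsto_shiftedAltSum_1 (k : ℕ) :
    Tendsto (shiftedAltSum (nest 1 unitSeq) k) atTop
      (𝓝 (ℓ ^ 2 / 2 + ℓ * (starSum k ![-1] - starSum k ![1]) - starSum k ![1, -1])) := by
  refine tendsto_shiftedAltSum_nest_one (c := fun k => ℓ ^ 2 / 2 +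
      ℓ * (starSum k ![-1] - starSum k ![1]) - starSum k ![1, -1])
    tendsto_altSum_one_unitSeq tendsto_shiftedAltSum_unitSeq ?_ (fun k => ?_) k
  · simpa [starSum_zero] using tendsto_altSum_11
  · simp [starSum_succ, starSum_vecEmpty, Int.sign_eq_one_of_pos]
    ring

lemma tendsto_shiftedAltSum_2 (k : ℕ) :
    Tendsto (shiftedAltSum (nest 2 unitSeq) k) atTop
      (𝓝 (zetaVal 2 * ℓ / 2 - zetaVal 3 / 4 + zetaVal 2 / 2 * starSum k ![-1]
        - ℓ * (starSum k ![-2] - starSum k ![2]) + starSum k ![2, -1])) := by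
  refine tendsto_shiftedAltSum_nest_two (c := fun k =>
      zetaVal 2 * ℓ / 2 - zetaVal 3 / 4 + zetaVal 2 / 2 * starSum k ![-1]
        - ℓ * (starSum k ![-2] - starSum k ![2]) + starSum k ![2, -1])
    tendsto_altSum_one_unitSeq tendsto_altSum_two_unitSeq tendsto_shiftedAltSum_unitSeq
    ?_ (fun k => ?_) k
  · simpa [starSum_zero] using tendsto_altSum_12
  · simp [starSum_succ, starSum_vecEmpty, Int.sign_eq_one_of_pos]
    ring

lemma tendsto_shiftedAltSum_3 (k : ℕ) :
    Tendsto (shiftedAltSum (nest 3 unitSeq) k) atTop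
      (𝓝 (3 / 4 * zetaVal 3 * ℓ - 5 / 16 * zetaVal 4 + 3 / 4 * zetaVal 3 * starSum k ![-1]
        - zetaVal 2 / 2 * starSum k ![-2] + ℓ * (starSum k ![-3] - starSum k ![3])
        - starSum k ![3, -1])) := by
  induction k with
  | zero =>
    rw [shiftedAltSum_zero]
    simpa [starSum_zero] using tendsto_altSum_13
  | succ k ih =>
    convert tendsto_shiftedAltSum_nest_three_succ tendsto_altSum_one_unitSeq
      tendsto_altSum_two_unitSeq tendsto_altSum_three_unitSeq ih
      (tendsto_shiftedAltSum_unitSeq (k + 1)) using 2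
    simp [starSum_succ, starSum_vecEmpty, Int.sign_eq_one_of_pos]
    ring

lemma tendsto_shiftedAltSum_11 (k : ℕ) :
    Tendsto (shiftedAltSum (nest 1 (nest 1 unitSeq)) k) atTop
      (𝓝 (-(ℓ ^ 3 / 6) - ℓ ^ 2 / 2 * (starSum k ![-1] - starSum k ![1])
        + ℓ * (starSum k ![1, -1] - starSum k ![1, 1]) - starSum k ![1, 1, -1])) := by
  refine tendsto_shiftedAltSum_nest_one (c := fun k =>
      -(ℓ ^ 3 / 6) - ℓ ^ 2 / 2 * (starSum k ![-1] - starSum k ![1])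
        + ℓ * (starSum k ![1, -1] - starSum k ![1, 1]) - starSum k ![1, 1, -1])
    tendsto_altSum_11 tendsto_shiftedAltSum_1 ?_ (fun k => ?_) k
  · simpa [starSum_zero] using tendsto_altSum_111
  · simp [starSum_succ, starSum_vecEmpty, Int.sign_eq_one_of_pos]
    ring

lemma tendsto_shiftedAltSum_111 (k : ℕ) :
    Tendsto (shiftedAltSum (nest 1 (nest 1 (nest 1 unitSeq))) k) atTop
      (𝓝 (ℓ ^ 4 / 24 + ℓ ^ 3 / 6 * (starSum k ![-1] - starSum k ![1])
        - ℓ ^ 2 / 2 * (starSum k ![1, -1] - starSum k ![1, 1])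
        + ℓ * (starSum k ![1, 1, -1] - starSum k ![1, 1, 1]) - starSum k ![1, 1, 1, -1])) := by
  refine tendsto_shiftedAltSum_nest_one (c := fun k =>
      ℓ ^ 4 / 24 + ℓ ^ 3 / 6 * (starSum k ![-1] - starSum k ![1])
        - ℓ ^ 2 / 2 * (starSum k ![1, -1] - starSum k ![1, 1])
        + ℓ * (starSum k ![1, 1, -1] - starSum k ![1, 1, 1]) - starSum k ![1, 1, 1, -1])
    tendsto_altSum_111 tendsto_shiftedAltSum_11 ?_ (fun k => ?_) k
  · simpa [starSum_zero] using tendsto_altSum_1111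
  · simp [starSum_succ, starSum_vecEmpty, Int.sign_eq_one_of_pos]
    ring

lemma tendsto_shiftedAltSum_12_add_21 (k : ℕ) :
    Tendsto (fun N => shiftedAltSum (nest 1 (nest 2 unitSeq)) k N +
        shiftedAltSum (nest 2 (nest 1 unitSeq)) k N) atTop
      (𝓝 (zetaVal 3 * ℓ / 8 - zetaVal 2 * ℓ ^ 2 / 4
        + (zetaVal 3 / 8 - zetaVal 2 * ℓ / 2) * starSum k ![-1]
        + (zetaVal 2 * ℓ / 2 - zetaVal 3 / 4) * starSum k ![1]
        + zetaVal 2 / 2 * starSum k ![1, -1]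
        - ℓ * (starSum k ![1, -2] - starSum k ![1, 2]) + starSum k ![1, 2, -1]
        + ℓ ^ 2 / 2 * (starSum k ![-2] - starSum k ![2])
        - ℓ * (starSum k ![2, -1] - starSum k ![2, 1]) + starSum k ![2, 1, -1])) := by
  -- The separate initial values stay unknown: each enters its closed form only as an additive
  -- constant, so adding the two leaves `s + t`.
  obtain ⟨s, t, hs, ht, hst⟩ := exists_tendsto_altSum_112_121
  have h1 := tendsto_shiftedAltSum_nest_one (c := fun k =>
      s - (zetaVal 2 * ℓ / 2 - zetaVal 3 / 4) * (starSum k ![-1] - starSum k ![1])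
        + zetaVal 2 / 2 * starSum k ![1, -1]
        - ℓ * (starSum k ![1, -2] - starSum k ![1, 2]) + starSum k ![1, 2, -1])
    tendsto_altSum_12 tendsto_shiftedAltSum_2 (by simpa [starSum_zero] using hs)
    (fun k => by simp [starSum_succ, starSum_vecEmpty, Int.sign_eq_one_of_pos]; ring) k
  have h2 := tendsto_shiftedAltSum_nest_two (c := fun k =>
      t - zetaVal 3 / 8 * starSum k ![-1] + ℓ ^ 2 / 2 * (starSum k ![-2] - starSum k ![2])
        - ℓ * (starSum k ![2, -1] - starSum k ![2, 1]) + starSum k ![2, 1, -1])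
    tendsto_altSum_11 tendsto_altSum_two_harmonic tendsto_shiftedAltSum_1
    (by simpa [starSum_zero] using ht)
    (fun k => by simp [starSum_succ, starSum_vecEmpty, Int.sign_eq_one_of_pos]; ring) k
  convert h1.add h2 using 2
  linear_combination -hst

end ClosedForms

/-! ### Quasi-shuffle expansion of the numerators -/

lemma genHarmonic_eq_nest (m n : ℕ) : genHarmonic m n = nest m unitSeq n := by
  induction n with
  | zero => simp [genHarmonic]
  | succ n ih => rw [genHarmonic_succ, nest_succ, ih, unitSeq_apply]

lemma genHarmonic_eq_starSum (n : ℕ) : genHarmonic 1 n = starSum n ![1] := by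
  simp [genHarmonic, starSum_vecCons, starSum_vecEmpty]

lemma genHarmonic_sq (n : ℕ) :
    genHarmonic 1 n ^ 2 = 2 * nest 1 (nest 1 unitSeq) n + nest 2 unitSeq n := by
  induction n with
  | zero => simp [genHarmonic]
  | succ n ih =>
    rw [genHarmonic_succ, nest_succ, nest_succ, ← genHarmonic_eq_nest 1, unitSeq_apply]
    simp only [div_eq_mul_inv, ← inv_pow]
    linear_combination ih

lemma genHarmonic_one_mul_two (n : ℕ) :
    genHarmonic 1 n * genHarmonic 2 n =
      nest 1 (nest 2 unitSeq) n + nest 2 (nest 1 unitSeq) n + nest 3 unitSeq n := by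
  induction n with
  | zero => simp [genHarmonic]
  | succ n ih =>
    rw [genHarmonic_succ, genHarmonic_succ, nest_succ, nest_succ, nest_succ,
      ← genHarmonic_eq_nest 1, ← genHarmonic_eq_nest 2, unitSeq_apply]
    simp only [div_eq_mul_inv, ← inv_pow]
    linear_combination ih

lemma genHarmonic_one_pow_three (n : ℕ) :
    genHarmonic 1 n ^ 3 = 6 * nest 1 (nest 1 (nest 1 unitSeq)) n +
      3 * (nest 1 (nest 2 unitSeq) n + nest 2 (nest 1 unitSeq) n) + nest 3 unitSeq n := by
  induction n with
  | zero => simp [genHarmonic]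
  | succ n ih =>
    have h := genHarmonic_sq n
    rw [genHarmonic_succ, nest_succ, nest_succ, nest_succ, nest_succ,
      ← genHarmonic_eq_nest 1, ← genHarmonic_eq_nest 2, unitSeq_apply]
    rw [← genHarmonic_eq_nest 2] at h
    simp only [div_eq_mul_inv, ← inv_pow]
    -- The increment of the cube contains `3 H_n^2/(n+1)`, which the expansion of the square
    -- resolves.
    linear_combination ih + 3 * ((n : ℝ) + 1)⁻¹ * h

lemma sum_Icc_eq_shiftedAltSum (f : ℕ → ℝ) (hf : f 0 = 0) (k N : ℕ) :
    ∑ n ∈ Icc 1 N, f n / ((n : ℝ) + ((k + 1 : ℕ) : ℝ)) * (-1 : ℝ) ^ (n + (k + 1)) =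
      shiftedAltSum f k (N + 1) := by
  rw [shiftedAltSum, range_eq_Ico, sum_eq_sum_Ico_succ_bot (by omega), hf]
  simp only [zero_mul, zero_div, zero_add]
  refine sum_congr (by ext; simp) fun n _ => ?_
  push_cast
  ring

end

theorem theorem1p1 (k : ℕ) (hk : 1 ≤ k) :
    Tendsto
      (fun N : ℕ => ∑ n ∈ Icc 1 N,
        genHarmonic 1 n * genHarmonic 2 n / ((n : ℝ) + (k : ℝ)) * (-1 : ℝ) ^ (n + k))
      atTop
      (𝓝 (-(5 / 16) * zetaVal 4 - 1 / 4 * zetaVal 2 * Real.log 2 ^ 2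
        + 7 / 8 * zetaVal 3 * Real.log 2
        + 7 / 8 * zetaVal 3 * starSum (k - 1) ![-1]
        - 1 / 4 * zetaVal 3 * genHarmonic 1 (k - 1)
        - 1 / 2 * zetaVal 2 * starSum (k - 1) ![-2]
        - starSum (k - 1) ![3, -1]
        + starSum (k - 1) ![1, 2, -1]
        + 1 / 2 * zetaVal 2 * starSum (k - 1) ![1, -1]
        + starSum (k - 1) ![2, 1, -1]
        + Real.log 2 * (starSum (k - 1) ![-3] - starSum (k - 1) ![3])
        - 1 / 2 * Real.log 2 * zetaVal 2 * (starSum (k - 1) ![-1] - starSum (k - 1) ![1])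
        + 1 / 2 * Real.log 2 ^ 2 * (starSum (k - 1) ![-2] - starSum (k - 1) ![2])
        - Real.log 2 * (starSum (k - 1) ![2, -1] - starSum (k - 1) ![2, 1])
        - Real.log 2 * (starSum (k - 1) ![1, -2] - starSum (k - 1) ![1, 2])))
    ∧
    Tendsto
      (fun N : ℕ => ∑ n ∈ Icc 1 N,
        genHarmonic 1 n ^ 3 / ((n : ℝ) + (k : ℝ)) * (-1 : ℝ) ^ (n + k))
      atTop
      (𝓝 (-(5 / 16) * zetaVal 4 + 9 / 8 * zetaVal 3 * Real.log 2
        - 3 / 4 * zetaVal 2 * Real.log 2 ^ 2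
        + 1 / 4 * Real.log 2 ^ 4
        + 9 / 8 * zetaVal 3 * starSum (k - 1) ![-1]
        - 1 / 2 * zetaVal 2 * starSum (k - 1) ![-2]
        - starSum (k - 1) ![3, -1]
        + 3 / 2 * zetaVal 2 * starSum (k - 1) ![1, -1]
        - 3 / 4 * zetaVal 3 * genHarmonic 1 (k - 1)
        + 3 * starSum (k - 1) ![1, 2, -1]
        + 3 * starSum (k - 1) ![2, 1, -1]
        - 6 * starSum (k - 1) ![1, 1, 1, -1]
        + Real.log 2 * (starSum (k - 1) ![-3] - starSum (k - 1) ![3])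
        - 3 * Real.log 2 * (starSum (k - 1) ![2, -1] - starSum (k - 1) ![2, 1])
        - 3 * Real.log 2 * (starSum (k - 1) ![1, -2] - starSum (k - 1) ![1, 2])
        + 6 * Real.log 2 * (starSum (k - 1) ![1, 1, -1] - starSum (k - 1) ![1, 1, 1])
        - 3 * Real.log 2 ^ 2 * (starSum (k - 1) ![1, -1] - starSum (k - 1) ![1, 1])
        + 3 / 2 * Real.log 2 ^ 2 * (starSum (k - 1) ![-2] - starSum (k - 1) ![2])
        + (Real.log 2 ^ 3 - 3 / 2 * Real.log 2 * zetaVal 2)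
          * (starSum (k - 1) ![-1] - starSum (k - 1) ![1]))) := by
  -- `shiftedAltSum` at `K` has denominators `n + K + 1`, so its parameter is `k - 1`.
  obtain ⟨K, rfl⟩ : ∃ K, k = K + 1 := ⟨k - 1, by omega⟩
  rw [Nat.add_sub_cancel, genHarmonic_eq_starSum]
  have h3 := tendsto_shiftedAltSum_3 K
  have h21 := tendsto_shiftedAltSum_12_add_21 K
  have h111 := tendsto_shiftedAltSum_111 K
  constructor
  · have h := (tendsto_add_atTop_iff_nat 1).2 (h21.add h3)
    convert h using 2 with N
    · rw [sum_Icc_eq_shiftedAltSum (fun n => genHarmonic 1 n * genHarmonic 2 n)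
        (by simp [genHarmonic])]
      simp only [shiftedAltSum, ← sum_add_distrib, genHarmonic_one_mul_two]
      exact sum_congr rfl fun n _ => by ring
    · ring
  · have h := (tendsto_add_atTop_iff_nat 1).2 (((h111.const_mul 6).add (h21.const_mul 3)).add h3)
    convert h using 2 with N
    · rw [sum_Icc_eq_shiftedAltSum (fun n => genHarmonic 1 n ^ 3) (by simp [genHarmonic])]
      simp only [shiftedAltSum, ← sum_add_distrib, mul_sum, genHarmonic_one_pow_three]
      exact sum_congr rfl fun n _ => by ring
    · ring
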